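/- Let $\Omega\subset\mathbb{R}^n$ be a bounded convex domain with smooth boundary and outer unit normal $\nu$, let $\alpha>1$, and let $d,\phi,\rho_0$ be $C^2$ functions on $\overline\Omega$ such that $d\ge c$ on $\overline\Omega$ for some constant $c>0$, $\rho_0>0$ on $\overline\Omega$ and $\int_\Omega\rho_0\,dx=1$. Let $\rho=\rho(x,t)$ be a positive classical solution of $$ \left\{\begin{aligned} \frac{\partial\rho}{\partial t}-\operatorname{div}(\rho\nabla\mu)&=0, && x\in\Omega,\ t>0,\\ \rho(x,0)&=\rho_0(x), && x\in\Omega,\\ \rho\nabla\mu\cdot\nu&=0, && x\in\partial\Omega,\ t>0, \end{aligned}\right. \qquad \mu:=\alpha\, d(x)\rho^{\alpha-1}+\phi(x), $$ that is, $\rho>0$ on $\overline\Omega\times[0,\infty)$, $\rho$ is continuous on $\overline\Omega\times[0,\infty)$, the derivatives $\partial_t\rho$, $\nabla\rho$, $\nabla^2\rho$ exist and are continuous on $\overline\Omega\times(0,\infty)$ (up to the boundary of $\Omega$), and the three equations hold pointwise. Define the free energy $$ \mathcal{F}[\rho](t):=\int_\Omega\bigl(d(x)\rho^\alpha+\rho\,\phi(x)\bigr)\,dx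 . $$ Then for every $t>0$ the integrals $\mathcal{F}[\rho](t)$ and $\int_\Omega|\nabla\mu|^2\rho\,dx$ converge, $\mathcal{F}[\rho]$ is differentiable at $t$, and $$ \frac{d}{dt}\mathcal{F}[\rho](t)=-\int_\Omega|\nabla\mu|^2\rho\,dx\le 0 . $$ -/

import Mathlib

open scoped ContDiff

noncomputable section

namespace NFP

/-- The Euclidean space `ℝⁿ`. -/
abbrev E (n : ℕ) : Type := EuclideanSpace ℝ (Fin n)

/-- The divergence `∑ i, ∂ᵢ Vᵢ` of a vector field on `ℝⁿ`. -/
def divergence {n : ℕ} (V : E n → E n) (x : E n) : ℝ :=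
  ∑ i : Fin n, (fderiv ℝ V x (EuclideanSpace.single i 1)) i

/-- `r` is a smooth function on the open neighbourhood `U` of `p`, without critical points,
such that `Ω ∩ U = {r < 0}`. -/
structure IsLocalDefiningFunction {n : ℕ} (Ω : Set (E n)) (p : E n) (U : Set (E n))
    (r : E n → ℝ) : Prop where
  isOpen : IsOpen U
  mem : p ∈ U
  smooth : ContDiffOn ℝ ∞ r U
  gradient_ne_zero : ∀ x ∈ U, gradient r x ≠ 0
  mem_iff : ∀ x ∈ U, x ∈ Ω ↔ r x < 0

/-- The boundary of `Ω` is smooth, and `Ω` lies locally on one side of it. -/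
def HasSmoothBoundary {n : ℕ} (Ω : Set (E n)) : Prop :=
  ∀ p ∈ frontier Ω, ∃ (U : Set (E n)) (r : E n → ℝ), IsLocalDefiningFunction Ω p U r

/-- `ν` is the outer unit normal vector of `Ω` at the boundary point `p`: the normalized gradient
of a function which defines `Ω` near `p` (it does not depend on that function). -/
def IsOuterUnitNormal {n : ℕ} (Ω : Set (E n)) (p ν : E n) : Prop :=
  p ∈ frontier Ω ∧ ∃ (U : Set (E n)) (r : E n → ℝ), IsLocalDefiningFunction Ω p U r ∧
    ν = ‖gradient r p‖⁻¹ • gradient r p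

/-- A bounded convex domain with smooth boundary. -/
structure IsSmoothBoundedConvexDomain {n : ℕ} (Ω : Set (E n)) : Prop where
  isOpen : IsOpen Ω
  nonempty : Ω.Nonempty
  isBounded : Bornology.IsBounded Ω
  convex : Convex ℝ Ω
  smoothBoundary : HasSmoothBoundary Ω

/-- `μ = α d ρ^(α-1) + φ`, where `ρ` is a function of the space variable. -/
def chemicalPotential {n : ℕ} (α : ℝ) (d φ ρ : E n → ℝ) (x : E n) : ℝ :=
  α * d x * ρ x ^ (α - 1) + φ x

/-- The density `d ρ^α + ρ φ` of the free energy. -/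
def freeEnergyDensity {n : ℕ} (α : ℝ) (d φ ρ : E n → ℝ) (x : E n) : ℝ :=
  d x * ρ x ^ α + ρ x * φ x

/-- The free energy `∫_Ω (d ρ^α + ρ φ) dx`. -/
def freeEnergy {n : ℕ} (Ω : Set (E n)) (α : ℝ) (d φ ρ : E n → ℝ) : ℝ :=
  ∫ x in Ω, freeEnergyDensity α d φ ρ x

/-- The density `|∇μ|² ρ` of the dissipation. -/
def dissipationDensity {n : ℕ} (α : ℝ) (d φ ρ : E n → ℝ) (x : E n) : ℝ :=
  ‖gradient (chemicalPotential α d φ ρ) x‖ ^ 2 * ρ x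

/-- `ρ`, a function of `(t, x)`, is of class `C^{2,1}` on `(0, ∞) × closure Ω` (twice in space, once
in time, up to the boundary of `Ω`), and continuous on `[0, ∞) × closure Ω`. Spatial derivatives
are taken within `closure Ω`, so that they make sense at boundary points; in the open set `Ω` they
are the ordinary ones. -/
structure IsClassicallyRegular {n : ℕ} (Ω : Set (E n)) (ρ : ℝ → E n → ℝ) : Prop where
  continuousOn : ContinuousOn (fun p : ℝ × E n => ρ p.1 p.2) (Set.Ici 0 ×ˢ closure Ω)
  contDiffOn_space : ∀ t, 0 < t → ContDiffOn ℝ 2 (ρ t) (closure Ω)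
  continuousOn_fderiv : ContinuousOn
    (fun p : ℝ × E n => fderivWithin ℝ (ρ p.1) (closure Ω) p.2) (Set.Ioi 0 ×ˢ closure Ω)
  continuousOn_fderiv_fderiv : ContinuousOn
    (fun p : ℝ × E n => fderivWithin ℝ (fderivWithin ℝ (ρ p.1) (closure Ω)) (closure Ω) p.2)
    (Set.Ioi 0 ×ˢ closure Ω)
  differentiableAt_time : ∀ t, 0 < t → ∀ x ∈ closure Ω, DifferentiableAt ℝ (fun s => ρ s x) t
  continuousOn_deriv_time : ContinuousOn
    (fun p : ℝ × E n => deriv (fun s => ρ s p.2) p.1) (Set.Ioi 0 ×ˢ closure Ω)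

/-- `ρ` is a positive classical solution of
`∂ρ/∂t - div (ρ ∇(α d ρ^(α-1) + φ)) = 0` in `Ω` for `t > 0`, with `ρ(0, ·) = ρ₀` in `Ω` and
`ρ ∇(α d ρ^(α-1) + φ) · ν = 0` on the boundary of `Ω` for `t > 0`. -/
structure IsPositiveClassicalSolution {n : ℕ} (Ω : Set (E n)) (α : ℝ) (d φ ρ₀ : E n → ℝ)
    (ρ : ℝ → E n → ℝ) : Prop where
  regular : IsClassicallyRegular Ω ρ
  pos : ∀ t, 0 ≤ t → ∀ x ∈ closure Ω, 0 < ρ t x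
  equation : ∀ t, 0 < t → ∀ x ∈ Ω,
    deriv (fun s => ρ s x) t
      - divergence (fun y => ρ t y • gradient (chemicalPotential α d φ (ρ t)) y) x = 0
  initial : ∀ x ∈ Ω, ρ 0 x = ρ₀ x
  boundary : ∀ t, 0 < t → ∀ x ∈ frontier Ω, ∀ ν : E n, IsOuterUnitNormal Ω x ν →
    inner ℝ (ρ t x • gradientWithin (chemicalPotential α d φ (ρ t)) (closure Ω) x) ν = 0

end NFP

end

/-!
The proof multiplies the equation by the chemical potential `μ`. Since `μ` is the derivative of the
free energy density `d ρ^α + ρ φ` with respect to `ρ`, differentiation under the integral sign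
(`NFP.hasDerivAt_freeEnergy`) gives `dF/dt = ∫ μ ∂ₜρ = ∫ μ div (ρ ∇μ)`, and as
`μ div (ρ ∇μ) = div (μ ρ ∇μ) - |∇μ|² ρ`, it remains to see that `∫ div X = 0` for the field
`X = μ ρ ∇μ`. This field is `C¹` up to the boundary, and the no-flux condition makes it tangential
there (`NFP.integral_mul_divergence_smul_gradient`).

The divergence theorem is needed for tangential fields only (`NFP.integral_divergence_eq_zero`),
which avoids surface measures. Let `g` be the Minkowski gauge of the convex set `Ω` about an
interior point, and let `η_m` be the Lipschitz cutoff equal to `m (1 - g)` truncated to `[0, 1]`.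
Integration by parts for Lipschitz functions gives `∫ η_m div X = -∫ dη_m(X)`. The left-hand side
tends to `∫ div X`. On the right-hand side, `dη_m = -m dg` in a layer of width `O(1 / m)` along the
boundary and `dη_m = 0` elsewhere. Because `g` is homogeneous, `dg` at a point `x` of the layer is
also the differential of `g` at the radial projection `p` of `x` to the boundary, where it is
conormal (`NFP.fderiv_apply_eq_zero_of_sublevel`) and hence annihilates `X p`. Thus
`dη_m(X) = -m dg(X x - X p)` is bounded independently of `m`
(`NFP.exists_bound_fderiv_cutoff_apply`), and dominated convergence shows that the right-hand side
tends to `0`.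
-/

open Set Filter Topology MeasureTheory
open scoped NNReal

namespace NFP

/-! ### The Minkowski gauge about an interior point -/

/-- The Minkowski gauge of `Ω` with respect to the centre `x₀`: for a convex neighbourhood `Ω` of
`x₀` it is the function equal to `1` on the boundary of `Ω` and positively homogeneous of degree
one along the rays from `x₀`. -/
noncomputable def gaugeAt {F : Type*} [AddCommGroup F] [Module ℝ F] (Ω : Set F) (x₀ x : F) : ℝ :=
  gauge ((fun y => y + x₀) ⁻¹' Ω) (x - x₀)

lemma preimage_add_right_mem_nhds_zero {F : Type*} [NormedAddCommGroup F] {Ω : Set F} {x₀ : F}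
    (hΩ : Ω ∈ 𝓝 x₀) : (fun y => y + x₀) ⁻¹' Ω ∈ 𝓝 (0 : F) := by
  have h : ContinuousAt (fun y : F => y + x₀) 0 := by fun_prop
  exact h.preimage_mem_nhds (by simpa using hΩ)

section gaugeAt

variable {F : Type*} [NormedAddCommGroup F] [NormedSpace ℝ F] {Ω : Set F} {x₀ : F}

lemma gaugeAt_ray (Ω : Set F) (x₀ x : F) {s : ℝ} (hs : 0 ≤ s) :
    gaugeAt Ω x₀ (x₀ + s • (x - x₀)) = s * gaugeAt Ω x₀ x := by
  simp only [gaugeAt, add_sub_cancel_left]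
  rw [gauge_smul_of_nonneg hs, smul_eq_mul]

lemma exists_lipschitzWith_gaugeAt (hc : Convex ℝ Ω) (hΩ : Ω ∈ 𝓝 x₀) :
    ∃ K, LipschitzWith K (gaugeAt Ω x₀) := by
  obtain ⟨K, hK⟩ := (hc.translate_preimage_left x₀).lipschitz_gauge
    (preimage_add_right_mem_nhds_zero hΩ)
  refine ⟨K, LipschitzWith.of_dist_le_mul fun x y => ?_⟩
  simpa [gaugeAt] using hK.dist_le_mul (x - x₀) (y - x₀)

lemma gaugeAt_lt_one_iff (hc : Convex ℝ Ω) (ho : IsOpen Ω) (hx₀ : x₀ ∈ Ω) (x : F) :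
    gaugeAt Ω x₀ x < 1 ↔ x ∈ Ω := by
  have ho' : IsOpen ((fun y => y + x₀) ⁻¹' Ω) := ho.preimage (by fun_prop)
  rw [gaugeAt, gauge_lt_one_iff_mem_interior (hc.translate_preimage_left x₀)
    (preimage_add_right_mem_nhds_zero (ho.mem_nhds hx₀)), ho'.interior_eq]
  simp

lemma gaugeAt_eq_one_iff (hc : Convex ℝ Ω) (hΩ : Ω ∈ 𝓝 x₀) (x : F) :
    gaugeAt Ω x₀ x = 1 ↔ x ∈ frontier Ω := by
  rw [gaugeAt, gauge_eq_one_iff_mem_frontier (hc.translate_preimage_left x₀)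
    (preimage_add_right_mem_nhds_zero hΩ)]
  have := (Homeomorph.addRight x₀).preimage_frontier Ω
  simp only [Homeomorph.coe_addRight] at this
  rw [← this]
  simp

/-- The derivative of the gauge is constant along the rays from the centre. -/
lemma hasFDerivAt_gaugeAt_ray {x : F} {l : F →L[ℝ] ℝ} (h : HasFDerivAt (gaugeAt Ω x₀) l x)
    {s : ℝ} (hs : 0 < s) : HasFDerivAt (gaugeAt Ω x₀) l (x₀ + s • (x - x₀)) := by
  have hfun : gaugeAt Ω x₀ = fun y => s * gaugeAt Ω x₀ (x₀ + s⁻¹ • (y - x₀)) := by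
    funext y
    rw [gaugeAt_ray _ _ _ (inv_nonneg.2 hs.le), mul_inv_cancel_left₀ hs.ne']
  have hx : x₀ + s⁻¹ • (x₀ + s • (x - x₀) - x₀) = x := by
    rw [add_sub_cancel_left, inv_smul_smul₀ hs.ne']; abel
  have hin : HasFDerivAt (fun y : F => x₀ + s⁻¹ • (y - x₀))
      (s⁻¹ • ContinuousLinearMap.id ℝ F) (x₀ + s • (x - x₀)) :=
    (((hasFDerivAt_id _).sub_const x₀).const_smul s⁻¹).const_add x₀
  have h' : HasFDerivAt (gaugeAt Ω x₀) l (x₀ + s⁻¹ • (x₀ + s • (x - x₀) - x₀)) := by rwa [hx]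
  have := (h'.comp (x₀ + s • (x - x₀)) hin).const_mul s
  rw [hfun]
  convert! this using 1
  ext v
  simp [hs.ne']

end gaugeAt

/-! ### The conormal direction at a boundary point -/

section conormal

variable {F : Type*} [NormedAddCommGroup F] [NormedSpace ℝ F]

/-- If `{r < r p}` lies in `{g < g p}` near `p`, then `dg(p)` vanishes on the kernel of
`dr(p) ≠ 0`: the two differentials are conormal to the same hypersurface. -/
lemma fderiv_apply_eq_zero_of_sublevel {g r : F → ℝ} {p : F} {l k : F →L[ℝ] ℝ}
    (hg : HasFDerivAt g l p) (hr : HasFDerivAt r k p) (hk : k ≠ 0)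
    (h : ∀ᶠ y in 𝓝 p, r y < r p → g y < g p) {v : F} (hv : k v = 0) : l v = 0 := by
  have key : ∀ w, k w < 0 → l w ≤ 0 := by
    intro w hw
    by_contra! hlw
    have hline : Tendsto (fun t : ℝ => p + t • w) (𝓝[>] 0) (𝓝 p) :=
      Tendsto.mono_left (Continuous.tendsto' (by fun_prop) _ _ (by simp)) inf_le_left
    have h1 := (hg.hasLineDerivAt w).tendsto_slope_zero_right.eventually (lt_mem_nhds hlw)
    have h2 := (hr.hasLineDerivAt w).tendsto_slope_zero_right.eventually (gt_mem_nhds hw)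
    obtain ⟨t, ht1, ht2, ht3, ht4⟩ :=
      (h1.and (h2.and ((hline.eventually h).and self_mem_nhdsWithin))).exists
    have ht : 0 < t⁻¹ := inv_pos.2 ht4
    rw [smul_eq_mul] at ht1 ht2
    have h3 := pos_of_mul_pos_right ht1 ht.le
    have h4 := neg_of_mul_neg_right ht2 ht.le
    linarith [ht3 (by linarith)]
  obtain ⟨u, hu⟩ : ∃ u, k u < 0 := by
    obtain ⟨u, hu⟩ : ∃ u, k u ≠ 0 := by
      by_contra! hall
      exact hk (ContinuousLinearMap.ext hall)
    rcases hu.lt_or_gt with hu | hu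
    · exact ⟨u, hu⟩
    · exact ⟨-u, by simpa using hu⟩
  by_contra hlv
  -- Translating `u` by a large multiple of `v` makes `l` positive without changing `k`.
  have := key (u + ((1 - l u) / l v) • v) (by simpa [hv] using hu)
  simp only [map_add, map_smul, smul_eq_mul, div_mul_cancel₀ _ hlv] at this
  linarith

end conormal

variable {n : ℕ} {Ω : Set (E n)}

lemma IsLocalDefiningFunction.eq_zero {p : E n} {U : Set (E n)} {r : E n → ℝ}
    (h : IsLocalDefiningFunction Ω p U r) (ho : IsOpen Ω) (hp : p ∈ frontier Ω) : r p = 0 := by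
  have hU : U ∈ 𝓝 p := h.isOpen.mem_nhds h.mem
  have hr : ContinuousAt r p := h.smooth.continuousOn.continuousAt hU
  rw [ho.frontier_eq] at hp
  have h1 : ¬ r p < 0 := fun hlt => hp.2 ((h.mem_iff p h.mem).2 hlt)
  have h2 : ¬ 0 < r p := by
    intro hlt
    obtain ⟨y, hy, hyU, hyr⟩ := ((mem_closure_iff_frequently.1 hp.1).and_eventually
      ((eventually_mem_set.2 hU).and (hr.eventually (lt_mem_nhds hlt)))).exists
    exact absurd ((h.mem_iff y hyU).1 hy) hyr.not_gt
  linarith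

/-- A vector field is tangential to the boundary of `Ω` at `p` if it is orthogonal to the outer
unit normals of `Ω` at `p`. Such vectors are annihilated by the differential of the gauge at any
interior point of the segment from the centre to `p`. -/
lemma fderiv_gaugeAt_apply_eq_zero (hc : Convex ℝ Ω) (ho : IsOpen Ω)
    (hs : HasSmoothBoundary Ω) {x₀ : E n} (hx₀ : x₀ ∈ Ω) {x : E n} {l : E n →L[ℝ] ℝ}
    (hl : HasFDerivAt (gaugeAt Ω x₀) l x) (hx : 0 < gaugeAt Ω x₀ x) {v : E n}
    (hv : ∀ ν, IsOuterUnitNormal Ω (x₀ + (gaugeAt Ω x₀ x)⁻¹ • (x - x₀)) ν → inner ℝ v ν = 0) :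
    l v = 0 := by
  have hgp := gaugeAt_ray Ω x₀ x (inv_nonneg.2 hx.le)
  rw [inv_mul_cancel₀ hx.ne'] at hgp
  have hlp := hasFDerivAt_gaugeAt_ray hl (inv_pos.2 hx)
  generalize x₀ + (gaugeAt Ω x₀ x)⁻¹ • (x - x₀) = p at *
  have hp : p ∈ frontier Ω := (gaugeAt_eq_one_iff hc (ho.mem_nhds hx₀) p).1 hgp
  obtain ⟨U, r, hr⟩ := hs p hp
  have hU : U ∈ 𝓝 p := hr.isOpen.mem_nhds hr.mem
  have hrd : DifferentiableAt ℝ r p := (hr.smooth.contDiffAt hU).differentiableAt (by simp)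
  have hg0 : gradient r p ≠ 0 := hr.gradient_ne_zero p hr.mem
  have hk : fderiv ℝ r p ≠ 0 := by
    intro h0
    apply hg0
    simp [gradient, h0]
  refine fderiv_apply_eq_zero_of_sublevel hlp hrd.hasFDerivAt hk ?_ ?_
  · filter_upwards [hU] with y hy hlt
    rw [hr.eq_zero ho hp] at hlt
    rw [hgp]
    exact (gaugeAt_lt_one_iff hc ho hx₀ y).2 ((hr.mem_iff y hy).2 hlt)
  · have := hv _ ⟨hp, U, r, hr, rfl⟩
    rw [inner_smul_right, mul_eq_zero, inv_eq_zero, norm_eq_zero, or_iff_right hg0,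
      real_inner_comm, inner_gradient_left] at this
    exact this

/-! ### Cutoff functions built from the gauge -/

/-- For `m > 0`, the cutoff function which is `0` outside `Ω`, `1` where the gauge is at most `1 - 1 / m`, and
affine in the gauge in between. -/
noncomputable def cutoff (Ω : Set (E n)) (x₀ : E n) (m : ℝ) (x : E n) : ℝ :=
  max (min (m * (1 - gaugeAt Ω x₀ x)) 1) 0

lemma cutoff_nonneg (Ω : Set (E n)) (x₀ : E n) (m : ℝ) (x : E n) : 0 ≤ cutoff Ω x₀ m x :=
  le_max_right _ _

lemma cutoff_le_one (Ω : Set (E n)) (x₀ : E n) (m : ℝ) (x : E n) : cutoff Ω x₀ m x ≤ 1 :=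
  max_le (min_le_right _ _) zero_le_one

lemma cutoff_eq_one {x₀ x : E n} {m : ℝ} (h : 1 ≤ m * (1 - gaugeAt Ω x₀ x)) :
    cutoff Ω x₀ m x = 1 := by
  rw [cutoff, min_eq_right h, max_eq_left zero_le_one]

lemma cutoff_eq_zero (hc : Convex ℝ Ω) (ho : IsOpen Ω) {x₀ x : E n} (hx₀ : x₀ ∈ Ω) {m : ℝ}
    (hm : 0 ≤ m) (hx : x ∉ Ω) : cutoff Ω x₀ m x = 0 := by
  rw [← gaugeAt_lt_one_iff hc ho hx₀, not_lt] at hx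
  exact max_eq_right ((min_le_left _ _).trans
    (mul_nonpos_of_nonneg_of_nonpos hm (sub_nonpos.2 hx)))

lemma exists_lipschitzWith_cutoff (hc : Convex ℝ Ω) (ho : IsOpen Ω) {x₀ : E n} (hx₀ : x₀ ∈ Ω)
    (m : ℝ) : ∃ K, LipschitzWith K (cutoff Ω x₀ m) := by
  obtain ⟨K, hK⟩ := exists_lipschitzWith_gaugeAt hc (ho.mem_nhds hx₀)
  have h1 : LipschitzWith (‖m‖₊ * (0 + K)) fun x => m * (1 - gaugeAt Ω x₀ x) := by
    have h := (lipschitzWith_smul m).comp ((LipschitzWith.const (1 : ℝ)).sub hK)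
    exact h
  exact ⟨_, (h1.min_const 1).max_const 0⟩

lemma eventually_one_le_mul_one_sub_gaugeAt {x₀ x : E n} (hx : gaugeAt Ω x₀ x < 1) :
    ∀ᶠ m : ℝ in atTop, 1 ≤ m * (1 - gaugeAt Ω x₀ x) := by
  filter_upwards [eventually_ge_atTop (1 - gaugeAt Ω x₀ x)⁻¹] with m hm
  rwa [← inv_le_iff_one_le_mul₀ (sub_pos.2 hx)]

lemma fderiv_cutoff_eq_zero_of_one_le {x₀ x : E n} {m : ℝ}
    (h : 1 ≤ m * (1 - gaugeAt Ω x₀ x)) : fderiv ℝ (cutoff Ω x₀ m) x = 0 := by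
  refine IsLocalMax.fderiv_eq_zero (Eventually.of_forall fun y => ?_)
  rw [cutoff_eq_one h]
  exact cutoff_le_one _ _ _ _

/-- The gradient of the cutoff is of size `m` in a boundary layer of width comparable to `1 / m`.
It is conormal to the boundary there, so paired with a Lipschitz field which is tangential at the
boundary it stays bounded, uniformly in `m`. -/
lemma exists_bound_fderiv_cutoff_apply (hΩ : IsSmoothBoundedConvexDomain Ω) {x₀ : E n}
    (hx₀ : x₀ ∈ Ω) {X : E n → E n} {K : ℝ≥0} (hX : LipschitzOnWith K X (closure Ω))
    (hb : ∀ p ∈ frontier Ω, ∀ ν, IsOuterUnitNormal Ω p ν → inner ℝ (X p) ν = 0) :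
    ∃ C : ℝ, ∀ m : ℝ, 2 ≤ m → ∀ x ∈ Ω, DifferentiableAt ℝ (gaugeAt Ω x₀) x →
      |fderiv ℝ (cutoff Ω x₀ m) x (X x)| ≤ C := by
  obtain ⟨G, hG⟩ := exists_lipschitzWith_gaugeAt hΩ.convex (hΩ.isOpen.mem_nhds hx₀)
  refine ⟨G * K * (2 * Metric.diam Ω), fun m hm x hx hd => ?_⟩
  have hdiam : 0 ≤ Metric.diam Ω := Metric.diam_nonneg
  by_cases h1 : 1 ≤ m * (1 - gaugeAt Ω x₀ x)
  · rw [fderiv_cutoff_eq_zero_of_one_le h1]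
    simp only [zero_apply, abs_zero]
    positivity
  push Not at h1
  have hlt : gaugeAt Ω x₀ x < 1 := (gaugeAt_lt_one_iff hΩ.convex hΩ.isOpen hx₀ x).2 hx
  have hhalf : 1 / 2 < gaugeAt Ω x₀ x := by nlinarith
  have hpos : 0 < gaugeAt Ω x₀ x := by linarith
  have hfd : fderiv ℝ (cutoff Ω x₀ m) x = -(m • fderiv ℝ (gaugeAt Ω x₀) x) := by
    have hev : cutoff Ω x₀ m =ᶠ[𝓝 x] fun y => m * (1 - gaugeAt Ω x₀ y) := by
      have hcont : ContinuousAt (fun y => m * (1 - gaugeAt Ω x₀ y)) x := by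
        have := hG.continuous
        fun_prop
      have hpos' : 0 < m * (1 - gaugeAt Ω x₀ x) := mul_pos (by linarith) (by linarith)
      filter_upwards [hcont.eventually (gt_mem_nhds h1), hcont.eventually (lt_mem_nhds hpos')]
        with y hy1 hy2
      rw [cutoff, min_eq_left hy1.le, max_eq_left hy2.le]
    rw [hev.fderiv_eq, fderiv_const_mul (hd.const_sub 1), fderiv_const_sub, smul_neg]
  set l := fderiv ℝ (gaugeAt Ω x₀) x with hl
  set s := gaugeAt Ω x₀ x with hs
  set p := x₀ + s⁻¹ • (x - x₀) with hp
  have hpf : p ∈ frontier Ω := by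
    rw [← gaugeAt_eq_one_iff hΩ.convex (hΩ.isOpen.mem_nhds hx₀), hp,
      gaugeAt_ray _ _ _ (inv_nonneg.2 hpos.le), inv_mul_cancel₀ hpos.ne']
  have hlp : l (X p) = 0 := fderiv_gaugeAt_apply_eq_zero hΩ.convex hΩ.isOpen hΩ.smoothBoundary hx₀
    hd.hasFDerivAt hpos (hb p hpf)
  have hlG : ‖l‖ ≤ G := norm_fderiv_le_of_lipschitz ℝ hG
  -- The radial projection onto the boundary moves a point of the layer by `O(1 / m)`.
  have hdist : m * ‖x - p‖ ≤ 2 * Metric.diam Ω := by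
    have h2 : x - p = (-(s⁻¹ * (1 - s))) • (x - x₀) := by
      have : -(s⁻¹ * (1 - s)) = 1 - s⁻¹ := by field_simp; ring
      rw [hp, this, sub_smul, one_smul]; abel
    have h3 : ‖x - x₀‖ ≤ Metric.diam Ω := by
      rw [← dist_eq_norm]
      exact Metric.dist_le_diam_of_mem hΩ.isBounded hx hx₀
    have h4 : s⁻¹ ≤ 2 := by
      rw [inv_le_comm₀ hpos two_pos]; linarith
    have h5 : 0 ≤ s⁻¹ * (1 - s) := mul_nonneg (inv_nonneg.2 hpos.le) (by linarith)
    rw [h2, norm_smul, norm_neg, Real.norm_of_nonneg h5]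
    calc m * (s⁻¹ * (1 - s) * ‖x - x₀‖) = s⁻¹ * (m * (1 - s)) * ‖x - x₀‖ := by ring
      _ ≤ 2 * 1 * Metric.diam Ω := by
        have : 0 ≤ m * (1 - s) := mul_nonneg (by linarith) (by linarith)
        gcongr
      _ = 2 * Metric.diam Ω := by ring
  have hXx : ‖X x - X p‖ ≤ K * ‖x - p‖ := hX.norm_sub_le (subset_closure hx)
    (frontier_subset_closure hpf)
  have heq : l (X x) = l (X x - X p) := by rw [map_sub, hlp, sub_zero]
  rw [hfd, neg_apply, smul_apply, smul_eq_mul, abs_neg,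
    abs_mul, abs_of_nonneg (by linarith : (0 : ℝ) ≤ m), heq, ← Real.norm_eq_abs]
  calc m * ‖l (X x - X p)‖ ≤ m * (G * (K * ‖x - p‖)) := by
        refine mul_le_mul_of_nonneg_left ?_ (by linarith)
        exact (l.le_opNorm _).trans (mul_le_mul hlG hXx (norm_nonneg _) G.2)
    _ = G * K * (m * ‖x - p‖) := by ring
    _ ≤ G * K * (2 * Metric.diam Ω) := by gcongr

/-! ### The divergence theorem for tangential fields -/

lemma sum_single_smul (v : E n) : ∑ i, v i • EuclideanSpace.single i (1 : ℝ) = v := by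
  simpa using (EuclideanSpace.basisFun (Fin n) ℝ).sum_repr v

/-- A field which is `C¹` up to the boundary and tangential there has total divergence zero. The
proof tests the divergence against the cutoff functions: their gradients are bounded along the
field and tend to `0` pointwise in `Ω`. -/
theorem integral_divergence_eq_zero (hΩ : IsSmoothBoundedConvexDomain Ω) {X : E n → E n}
    (hX : ContDiffOn ℝ 1 X (closure Ω))
    (hb : ∀ p ∈ frontier Ω, ∀ ν, IsOuterUnitNormal Ω p ν → inner ℝ (X p) ν = 0) :
    IntegrableOn (divergence X) Ω ∧ ∫ x in Ω, divergence X x = 0 := by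
  obtain ⟨x₀, hx₀⟩ := hΩ.nonempty
  have hK : IsCompact (closure Ω) := hΩ.isBounded.isCompact_closure
  have hΩm : MeasurableSet Ω := hΩ.isOpen.measurableSet
  have hΩfin : volume Ω < ⊤ := hΩ.isBounded.measure_lt_top
  obtain ⟨K, hXK⟩ := hX.exists_lipschitzOnWith one_ne_zero hΩ.convex.closure hK
  have hext : ∀ i : Fin n, ∃ Y : E n → ℝ, LipschitzWith K Y ∧
      EqOn (fun x => X x i) Y (closure Ω) := by
    intro i
    refine LipschitzOnWith.extend_real (LipschitzOnWith.of_dist_le_mul fun x hx y hy => ?_)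
    refine le_trans ?_ (hXK.dist_le_mul x hx y hy)
    rw [dist_eq_norm, dist_eq_norm]
    exact PiLp.norm_apply_le (X x - X y) i
  choose Y hYL hYX using hext
  set e : Fin n → E n := fun i => EuclideanSpace.single i (1 : ℝ) with he
  have hdiv : ∀ x ∈ Ω, divergence X x = ∑ i, lineDeriv ℝ (Y i) x (e i) := by
    intro x hx
    have hnhds : closure Ω ∈ 𝓝 x := mem_of_superset (hΩ.isOpen.mem_nhds hx) subset_closure
    have hXd : DifferentiableAt ℝ X x := (hX.contDiffAt hnhds).differentiableAt one_ne_zero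
    refine Finset.sum_congr rfl fun i _ => ?_
    have hXi : HasFDerivAt (fun y => X y i)
        ((EuclideanSpace.proj i : E n →L[ℝ] ℝ).comp (fderiv ℝ X x)) x :=
      (EuclideanSpace.proj i : E n →L[ℝ] ℝ).hasFDerivAt.comp x hXd.hasFDerivAt
    have hYi : HasFDerivAt (Y i)
        ((EuclideanSpace.proj i : E n →L[ℝ] ℝ).comp (fderiv ℝ X x)) x :=
      hXi.congr_of_eventuallyEq (by filter_upwards [hnhds] with y hy using (hYX i hy).symm)
    rw [(hYi.hasLineDerivAt (e i)).lineDeriv]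
    rfl
  have hlineint : ∀ {C : ℝ≥0} {f : E n → ℝ}, LipschitzWith C f → ∀ v,
      IntegrableOn (fun x => lineDeriv ℝ f x v) (closure Ω) := fun hf v =>
    (hf.locallyIntegrable_lineDeriv v).integrableOn_isCompact hK
  have hdivint : IntegrableOn (divergence X) Ω := by
    refine IntegrableOn.congr_fun ?_ (fun x hx => (hdiv x hx).symm) hΩm
    exact integrable_finsetSum _ fun i _ => (hlineint (hYL i) (e i)).mono_set subset_closure
  refine ⟨hdivint, ?_⟩
  set η : ℕ → E n → ℝ := fun k => cutoff Ω x₀ (k + 2 : ℝ) with hη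
  have hk2 : ∀ k : ℕ, (2 : ℝ) ≤ k + 2 := fun k => by linarith [k.cast_nonneg (α := ℝ)]
  have hk0 : ∀ k : ℕ, (0 : ℝ) ≤ k + 2 := fun k => by linarith [hk2 k]
  have hηL : ∀ k, ∃ C, LipschitzWith C (η k) := fun k =>
    exists_lipschitzWith_cutoff hΩ.convex hΩ.isOpen hx₀ _
  have hη0 : ∀ k, ∀ x ∉ Ω, η k x = 0 := fun k x hx =>
    cutoff_eq_zero hΩ.convex hΩ.isOpen hx₀ (hk0 k) hx
  have hηc : ∀ k, HasCompactSupport (η k) := fun k =>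
    HasCompactSupport.intro hK fun x hx => hη0 k x fun h => hx (subset_closure h)
  have htend : ∀ x ∈ Ω, ∀ᶠ k : ℕ in atTop, 1 ≤ (k + 2 : ℝ) * (1 - gaugeAt Ω x₀ x) := by
    intro x hx
    have hlt : gaugeAt Ω x₀ x < 1 := (gaugeAt_lt_one_iff hΩ.convex hΩ.isOpen hx₀ x).2 hx
    exact (tendsto_atTop_add_const_right _ (2 : ℝ) tendsto_natCast_atTop_atTop).eventually
      (eventually_one_le_mul_one_sub_gaugeAt hlt)
  obtain ⟨G, hG⟩ := exists_lipschitzWith_gaugeAt hΩ.convex (hΩ.isOpen.mem_nhds hx₀)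
  have hae : ∀ᵐ x ∂(volume.restrict Ω), x ∈ Ω ∧ DifferentiableAt ℝ (gaugeAt Ω x₀) x ∧
      ∀ k, DifferentiableAt ℝ (η k) x := by
    refine (ae_restrict_mem hΩm).and (ae_restrict_of_ae ?_)
    refine hG.ae_differentiableAt.and (ae_all_iff.2 fun k => ?_)
    obtain ⟨C, hC⟩ := hηL k
    exact hC.ae_differentiableAt
  have hparts : ∀ k, ∫ x in Ω, divergence X x * η k x =
      ∫ x in Ω, -fderiv ℝ (η k) x (X x) := by
    intro k
    obtain ⟨C, hC⟩ := hηL k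
    have hint1 : ∀ i, IntegrableOn (fun x => lineDeriv ℝ (Y i) x (e i) * η k x) Ω := fun i =>
      ((hlineint (hYL i) (e i)).mul_continuousOn hC.continuous.continuousOn hK).mono_set
        subset_closure
    have hint2 : ∀ i, IntegrableOn (fun x => lineDeriv ℝ (η k) x (-e i) * Y i x) Ω := fun i =>
      ((hlineint hC (-e i)).mul_continuousOn (hYL i).continuous.continuousOn hK).mono_set
        subset_closure
    calc ∫ x in Ω, divergence X x * η k x
        = ∫ x in Ω, ∑ i, lineDeriv ℝ (Y i) x (e i) * η k x :=
          setIntegral_congr_fun hΩm fun x hx => by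
            simp only [hdiv x hx, Finset.sum_mul]
      _ = ∑ i, ∫ x in Ω, lineDeriv ℝ (Y i) x (e i) * η k x :=
          integral_finsetSum _ fun i _ => hint1 i
      _ = ∑ i, ∫ x in Ω, lineDeriv ℝ (η k) x (-e i) * Y i x := by
          refine Finset.sum_congr rfl fun i _ => ?_
          rw [setIntegral_eq_integral_of_forall_compl_eq_zero,
            setIntegral_eq_integral_of_forall_compl_eq_zero]
          · exact (hYL i).integral_lineDeriv_mul_eq hC (hηc k) (e i)
          · intro x hx
            by_cases hd : LineDifferentiableAt ℝ (η k) x (-e i)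
            · -- Off `Ω` the cutoff attains its minimum `0`, so its line derivatives vanish.
              have hmin : IsLocalMin (fun t : ℝ => η k (x + t • -e i)) 0 :=
                Eventually.of_forall fun t => by
                  simp only [zero_smul, add_zero, hη0 k x hx]
                  exact cutoff_nonneg _ _ _ _
              rw [lineDeriv, hmin.deriv_eq_zero, zero_mul]
            · rw [lineDeriv_zero_of_not_lineDifferentiableAt hd, zero_mul]
          · intro x hx
            rw [hη0 k x hx, mul_zero]
      _ = ∫ x in Ω, ∑ i, lineDeriv ℝ (η k) x (-e i) * Y i x :=
          (integral_finsetSum _ fun i _ => hint2 i).symm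
      _ = ∫ x in Ω, -fderiv ℝ (η k) x (X x) := by
          refine integral_congr_ae ?_
          filter_upwards [hae] with x hx
          obtain ⟨hxΩ, -, hxd⟩ := hx
          conv_rhs => rw [← sum_single_smul (X x), map_sum, ← Finset.sum_neg_distrib]
          refine Finset.sum_congr rfl fun i _ => ?_
          rw [(hxd k).lineDeriv_eq_fderiv, ← hYX i (subset_closure hxΩ), map_neg, map_smul,
            smul_eq_mul]
          ring
  have hlim1 : Tendsto (fun k => ∫ x in Ω, divergence X x * η k x) atTop
      (𝓝 (∫ x in Ω, divergence X x)) := by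
    refine tendsto_integral_of_dominated_convergence (fun x => ‖divergence X x‖) ?_
      hdivint.norm ?_ ?_
    · intro k
      obtain ⟨C, hC⟩ := hηL k
      exact hdivint.aestronglyMeasurable.mul hC.continuous.aestronglyMeasurable
    · refine fun k => ae_of_all _ fun x => ?_
      rw [norm_mul, Real.norm_of_nonneg (cutoff_nonneg _ _ _ _)]
      exact mul_le_of_le_one_right (norm_nonneg _) (cutoff_le_one _ _ _ _)
    · filter_upwards [ae_restrict_mem hΩm] with x hx
      refine tendsto_const_nhds.congr' ?_
      filter_upwards [htend x hx] with k hk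
      simp only [hη, cutoff_eq_one hk, mul_one]
  have hlim2 : Tendsto (fun k => ∫ x in Ω, -fderiv ℝ (η k) x (X x)) atTop (𝓝 0) := by
    obtain ⟨C, hC⟩ := exists_bound_fderiv_cutoff_apply hΩ hx₀ hXK hb
    have h0 : (0 : ℝ) = ∫ x in Ω, (0 : ℝ) := by simp
    rw [h0]
    refine tendsto_integral_of_dominated_convergence (fun _ => C) ?_
      (integrableOn_const hΩfin.ne) ?_ ?_
    · intro k
      have hXm : AEStronglyMeasurable X (volume.restrict Ω) :=
        (hX.continuousOn.mono subset_closure).aestronglyMeasurable hΩm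
      have hm : AEStronglyMeasurable (fun x => fderiv ℝ (η k) x) (volume.restrict Ω) :=
        (measurable_fderiv ℝ (η k)).aestronglyMeasurable
      exact (isBoundedBilinearMap_apply.continuous.comp_aestronglyMeasurable
        (hm.prodMk hXm)).neg
    · intro k
      filter_upwards [hae] with x hx
      rw [norm_neg, Real.norm_eq_abs]
      exact hC _ (hk2 k) x hx.1 hx.2.1
    · filter_upwards [ae_restrict_mem hΩm] with x hx
      refine tendsto_const_nhds.congr' ?_
      filter_upwards [htend x hx] with k hk
      simp only [hη, fderiv_cutoff_eq_zero_of_one_le hk, zero_apply, neg_zero]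
  refine tendsto_nhds_unique hlim1 ?_
  simp only [hparts]
  exact hlim2

/-! ### The dissipation identity -/

/-- The product rule `div (f W) = f div W + ∇f · W`. -/
lemma divergence_smul {f : E n → ℝ} {W : E n → E n} {x : E n} (hf : DifferentiableAt ℝ f x)
    (hW : DifferentiableAt ℝ W x) :
    divergence (fun y => f y • W y) x = f x * divergence W x + inner ℝ (gradient f x) (W x) := by
  have hinner : inner ℝ (gradient f x) (W x) =
      ∑ i, fderiv ℝ f x (EuclideanSpace.single i 1) * W x i := by
    rw [inner_gradient_left]
    conv_lhs => rw [← sum_single_smul (W x), map_sum]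
    refine Finset.sum_congr rfl fun i _ => ?_
    rw [map_smul, smul_eq_mul, mul_comm]
  rw [hinner, divergence, divergence, Finset.mul_sum, ← Finset.sum_add_distrib]
  refine Finset.sum_congr rfl fun i _ => ?_
  rw [fderiv_fun_smul hf hW]
  simp

lemma divergence_congr {V W : E n → E n} {x : E n} (h : V =ᶠ[𝓝 x] W) :
    divergence V x = divergence W x := by
  rw [divergence, divergence, h.fderiv_eq]

lemma contDiffOn_chemicalPotential {α : ℝ} {d φ u : E n → ℝ} {s : Set (E n)}
    (hd : ContDiffOn ℝ 2 d s) (hφ : ContDiffOn ℝ 2 φ s) (hu : ContDiffOn ℝ 2 u s)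
    (hpos : ∀ x ∈ s, 0 < u x) : ContDiffOn ℝ 2 (chemicalPotential α d φ u) s :=
  ((contDiffOn_const.mul hd).mul (hu.rpow_const_of_ne fun x hx => (hpos x hx).ne')).add hφ

lemma gradientWithin_eq_gradient {f : E n → ℝ} {s : Set (E n)} {x : E n} (h : s ∈ 𝓝 x) :
    gradientWithin f s x = gradient f x := by
  rw [gradientWithin, gradient, fderivWithin_of_mem_nhds h]

lemma contDiffOn_gradientWithin {f : E n → ℝ} {s : Set (E n)} (hf : ContDiffOn ℝ 2 f s)
    (hs : UniqueDiffOn ℝ s) : ContDiffOn ℝ 1 (gradientWithin f s) s :=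
  (InnerProductSpace.toDual ℝ (E n)).symm.contDiff.comp_contDiffOn
    (hf.fderivWithin hs (by norm_num))

/-- For a field `u ∇f` satisfying the no-flux condition, integration by parts gives
`∫ f div (u ∇f) = -∫ |∇f|² u` without a boundary term. -/
theorem integral_mul_divergence_smul_gradient (hΩ : IsSmoothBoundedConvexDomain Ω)
    {f u : E n → ℝ} (hf : ContDiffOn ℝ 2 f (closure Ω)) (hu : ContDiffOn ℝ 1 u (closure Ω))
    (hb : ∀ p ∈ frontier Ω, ∀ ν, IsOuterUnitNormal Ω p ν →
      inner ℝ (u p • gradientWithin f (closure Ω) p) ν = 0) :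
    IntegrableOn (fun x => ‖gradient f x‖ ^ 2 * u x) Ω ∧
      ∫ x in Ω, f x * divergence (fun y => u y • gradient f y) x =
        -∫ x in Ω, ‖gradient f x‖ ^ 2 * u x := by
  have hΩm : MeasurableSet Ω := hΩ.isOpen.measurableSet
  have hnhds : ∀ x ∈ Ω, closure Ω ∈ 𝓝 x := fun x hx =>
    mem_of_superset (hΩ.isOpen.mem_nhds hx) subset_closure
  have hu' : UniqueDiffOn ℝ (closure Ω) := uniqueDiffOn_convex hΩ.convex.closure
    (hΩ.nonempty.mono (interior_maximal subset_closure hΩ.isOpen))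
  have hV : ContDiffOn ℝ 1 (gradientWithin f (closure Ω)) (closure Ω) :=
    contDiffOn_gradientWithin hf hu'
  have hW : ContDiffOn ℝ 1 (fun y => u y • gradientWithin f (closure Ω) y) (closure Ω) :=
    hu.smul hV
  have hX : ContDiffOn ℝ 1 (fun y => f y • (u y • gradientWithin f (closure Ω) y)) (closure Ω) :=
    (hf.of_le one_le_two).smul hW
  obtain ⟨hint, hzero⟩ := integral_divergence_eq_zero hΩ hX fun p hp ν hν => by
    rw [inner_smul_left, hb p hp ν hν, mul_zero]
  have hdiss : IntegrableOn (fun x => ‖gradient f x‖ ^ 2 * u x) Ω := by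
    have hc : ContinuousOn (fun x => ‖gradientWithin f (closure Ω) x‖ ^ 2 * u x) (closure Ω) :=
      (hV.continuousOn.norm.pow 2).mul hu.continuousOn
    refine ((hc.integrableOn_compact hΩ.isBounded.isCompact_closure).mono_set
      subset_closure).congr_fun (fun x hx => ?_) hΩm
    simp only [gradientWithin_eq_gradient (hnhds x hx)]
  refine ⟨hdiss, ?_⟩
  have hpt : EqOn (fun x => f x * divergence (fun y => u y • gradient f y) x)
      (fun x => divergence (fun y => f y • (u y • gradientWithin f (closure Ω) y)) x
        - ‖gradient f x‖ ^ 2 * u x) Ω := by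
    intro x hx
    have hev : (fun y => u y • gradient f y) =ᶠ[𝓝 x]
        fun y => u y • gradientWithin f (closure Ω) y := by
      filter_upwards [hΩ.isOpen.mem_nhds hx] with y hy
      rw [gradientWithin_eq_gradient (hnhds y hy)]
    simp only
    rw [divergence_smul ((hf.contDiffAt (hnhds x hx)).differentiableAt two_ne_zero)
      ((hW.contDiffAt (hnhds x hx)).differentiableAt one_ne_zero), divergence_congr hev,
      gradientWithin_eq_gradient (hnhds x hx), real_inner_smul_right, real_inner_self_eq_norm_sq]
    ring
  rw [setIntegral_congr_fun hΩm hpt, integral_sub hint hdiss, hzero, zero_sub]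

/-! ### Differentiation of the free energy in time -/

/-- The chemical potential is the derivative of the free energy density with respect to the
density. -/
lemma hasDerivAt_freeEnergyDensity {α : ℝ} {d φ : E n → ℝ} {ρ : ℝ → E n → ℝ} {t : ℝ} {x : E n}
    (h : DifferentiableAt ℝ (fun s => ρ s x) t) (hpos : 0 < ρ t x) :
    HasDerivAt (fun s => freeEnergyDensity α d φ (ρ s) x)
      (chemicalPotential α d φ (ρ t) x * deriv (fun s => ρ s x) t) t := by
  have h1 := h.hasDerivAt
  have h2 := ((h1.rpow_const (p := α) (Or.inl hpos.ne')).const_mul (d x)).add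
    (h1.mul_const (φ x))
  refine h2.congr_deriv ?_
  rw [chemicalPotential]
  ring

lemma continuousOn_freeEnergyDensity {α : ℝ} {d φ u : E n → ℝ} {s : Set (E n)}
    (hd : ContinuousOn d s) (hφ : ContinuousOn φ s) (hu : ContinuousOn u s)
    (hpos : ∀ x ∈ s, 0 < u x) : ContinuousOn (freeEnergyDensity α d φ u) s :=
  (hd.mul (hu.rpow_const fun x hx => Or.inl (hpos x hx).ne')).add (hu.mul hφ)

/-- Differentiation under the integral sign in the free energy. The dominating function is a
constant, since `μ ∂ₜρ` is continuous on the compact set `[t / 2, 2 t] × closure Ω`. -/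
theorem hasDerivAt_freeEnergy (hm : MeasurableSet Ω) (hΩ : Bornology.IsBounded Ω) {α : ℝ}
    {d φ : E n → ℝ} (hd : ContinuousOn d (closure Ω)) (hφ : ContinuousOn φ (closure Ω))
    {ρ : ℝ → E n → ℝ} (hρ : IsClassicallyRegular Ω ρ)
    (hpos : ∀ t, 0 ≤ t → ∀ x ∈ closure Ω, 0 < ρ t x) {t : ℝ} (ht : 0 < t) :
    IntegrableOn (freeEnergyDensity α d φ (ρ t)) Ω ∧
    HasDerivAt (fun s => freeEnergy Ω α d φ (ρ s))
      (∫ x in Ω, chemicalPotential α d φ (ρ t) x * deriv (fun s => ρ s x) t) t := by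
  have hK : IsCompact (closure Ω) := hΩ.isCompact_closure
  have hslice : ∀ s : ℝ, 0 < s → ContinuousOn (freeEnergyDensity α d φ (ρ s)) (closure Ω) :=
    fun s hs => continuousOn_freeEnergyDensity hd hφ (hρ.contDiffOn_space s hs).continuousOn
      (hpos s hs.le)
  have hint : IntegrableOn (freeEnergyDensity α d φ (ρ t)) Ω :=
    ((hslice t ht).integrableOn_compact hK).mono_set subset_closure
  have hcont : ContinuousOn (fun p : ℝ × E n =>
      chemicalPotential α d φ (ρ p.1) p.2 * deriv (fun s => ρ s p.2) p.1)
      (Ioi 0 ×ˢ closure Ω) := by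
    have hsnd : MapsTo Prod.snd (Ioi (0 : ℝ) ×ˢ closure Ω) (closure Ω) := fun p hp => hp.2
    have hρc : ContinuousOn (fun p : ℝ × E n => ρ p.1 p.2) (Ioi 0 ×ˢ closure Ω) :=
      hρ.continuousOn.mono (prod_mono Ioi_subset_Ici_self Subset.rfl)
    refine ContinuousOn.mul ?_ hρ.continuousOn_deriv_time
    exact ((continuousOn_const.mul (hd.comp continuousOn_snd hsnd)).mul
      (hρc.rpow_const fun p hp => Or.inl (hpos p.1 hp.1.le p.2 hp.2).ne')).add
      (hφ.comp continuousOn_snd hsnd)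
  have hsub : Icc (t / 2) (2 * t) ⊆ Ioi 0 := fun s hs => lt_of_lt_of_le (by positivity) hs.1
  obtain ⟨C, hC⟩ := (isCompact_Icc.prod hK).exists_bound_of_continuousOn
    (hcont.mono (prod_mono hsub Subset.rfl))
  refine ⟨hint, (hasDerivAt_integral_of_dominated_loc_of_deriv_le
    (μ := volume.restrict Ω) (bound := fun _ => C)
    (F := fun s x => freeEnergyDensity α d φ (ρ s) x)
    (F' := fun s x => chemicalPotential α d φ (ρ s) x * deriv (fun r => ρ r x) s)
    (Icc_mem_nhds (by linarith : t / 2 < t) (by linarith : t < 2 * t)) ?_ hint ?_ ?_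
    (integrableOn_const hΩ.measure_lt_top.ne) ?_).2⟩
  · filter_upwards [Ioi_mem_nhds ht] with s hs
    exact ((hslice s hs).mono subset_closure).aestronglyMeasurable hm
  · refine ContinuousOn.aestronglyMeasurable ?_ hm
    exact hcont.comp (f := fun x => (t, x)) (by fun_prop) fun x hx => ⟨ht, subset_closure hx⟩
  · filter_upwards [ae_restrict_mem hm] with x hx s hs
    exact hC (s, x) ⟨hs, subset_closure hx⟩
  · filter_upwards [ae_restrict_mem hm] with x hx s hs
    exact hasDerivAt_freeEnergyDensity
      (hρ.differentiableAt_time s (hsub hs) x (subset_closure hx))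
      (hpos s (hsub hs).le x (subset_closure hx))

end NFP

theorem mainTheorem2 (n : ℕ) (Ω : Set (NFP.E n)) (hΩ : NFP.IsSmoothBoundedConvexDomain Ω)
    (α : ℝ) (hα : 1 < α) (d φ ρ₀ : NFP.E n → ℝ)
    (hd : ContDiffOn ℝ 2 d (closure Ω)) (hφ : ContDiffOn ℝ 2 φ (closure Ω))
    (hρ₀ : ContDiffOn ℝ 2 ρ₀ (closure Ω))
    (hd_min : ∃ c : ℝ, 0 < c ∧ ∀ x ∈ closure Ω, c ≤ d x)
    (hρ₀_pos : ∀ x ∈ closure Ω, 0 < ρ₀ x) (hρ₀_int : ∫ x in Ω, ρ₀ x = 1)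
    (ρ : ℝ → NFP.E n → ℝ) (hρ : NFP.IsPositiveClassicalSolution Ω α d φ ρ₀ ρ) :
    ∀ t : ℝ, 0 < t →
      MeasureTheory.IntegrableOn (NFP.freeEnergyDensity α d φ (ρ t)) Ω ∧
      MeasureTheory.IntegrableOn (NFP.dissipationDensity α d φ (ρ t)) Ω ∧
      HasDerivAt (fun s => NFP.freeEnergy Ω α d φ (ρ s))
        (-∫ x in Ω, NFP.dissipationDensity α d φ (ρ t) x) t ∧
      -∫ x in Ω, NFP.dissipationDensity α d φ (ρ t) x ≤ 0 := by
  intro t ht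
  have hm : MeasurableSet Ω := hΩ.isOpen.measurableSet
  have hu := hρ.regular.contDiffOn_space t ht
  have hpos := hρ.pos t ht.le
  obtain ⟨hF, hderiv⟩ := NFP.hasDerivAt_freeEnergy (α := α) hm hΩ.isBounded hd.continuousOn
    hφ.continuousOn hρ.regular hρ.pos ht
  obtain ⟨hD, hparts⟩ := NFP.integral_mul_divergence_smul_gradient hΩ
    (NFP.contDiffOn_chemicalPotential (α := α) hd hφ hu hpos) (hu.of_le one_le_two)
    (hρ.boundary t ht)
  refine ⟨hF, hD, ?_, ?_⟩
  · refine hderiv.congr_deriv (Eq.trans ?_ hparts)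
    refine setIntegral_congr_fun hm fun x hx => ?_
    simp only [sub_eq_zero.1 (hρ.equation t ht x hx)]
  · refine neg_nonpos.2 (setIntegral_nonneg hm fun x hx => ?_)
    exact mul_nonneg (sq_nonneg _) (hpos x (subset_closure hx)).le
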